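/- All Hilbert spaces are finite-dimensional, and $\log$ denotes the logarithm to base $2$. Let $S_=(\mathcal H)$ and $S_\le(\mathcal H)$ be the sets of positive semidefinite operators $\rho$ on $\mathcal H$ with $\operatorname{tr}\rho=1$ and with $0<\operatorname{tr}\rho\le 1$, respectively. Write $\|O\|_1=\operatorname{tr}\sqrt{O^\dagger O}$. For $\rho,\sigma\in S_\le(\mathcal H)$ let $$F(\rho,\sigma)=\|\sqrt\rho\sqrt\sigma\|_1+\sqrt{(1-\operatorname{tr}\rho)(1-\operatorname{tr}\sigma)},\qquad P(\rho,\sigma)=\sqrt{1-F(\rho,\sigma)^2},$$ and let $\mathcal B^{\varepsilon}(\rho)=\{\rho'\in S_\le(\mathcal H):P(\rho,\rho')\le\varepsilon\}$. Let $D_{\max}(\rho\|\sigma)=\min\{\lambda\in\mathbb R: 2^{\lambda}\sigma\ge\rho\}$ (equal to $+\infty$ if there is no such $\lambda$). For $\rho_{AB}\in S_\le(\mathcal H_A\otimes\mathcal H_B)$, with reduced operators $\rho_A,\rho_B$, define $${}^1I_{\max}(A:B)_\rho=D_{\max}(\rho_{AB}\|\rho_A\otimes\rho_B),\qquad H_{\min}(A|B)_\rho=-\min_{\sigma_B\in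 S_=(\mathcal H_B)}D_{\max}(\rho_{AB}\|\mathbb I_A\otimes\sigma_B),\qquad H_{\max}(A)_\rho=\log\|\sqrt{\rho_A}\|_1^2,$$ and their smooth versions $${}^1I^{\varepsilon}_{\max}(A:B)_\rho=\min_{\rho'\in\mathcal B^{\varepsilon}(\rho_{AB})}{}^1I_{\max}(A:B)_{\rho'},\qquad H^{\varepsilon}_{\min}(A|B)_\rho=\max_{\rho'\in\mathcal B^{\varepsilon}(\rho_{AB})}H_{\min}(A|B)_{\rho'},\qquad H^{\varepsilon}_{\max}(A)_\rho=\min_{\rho'\in\mathcal B^{\varepsilon}(\rho_{A})}H_{\max}(A)_{\rho'}.$$ Corollary (upper chain rule for ${}^1I_{\max}$). Let $\rho\in S_=(\mathcal H_A\otimes\mathcal H_B)$ and let $\varepsilon,\varepsilon'>0$ satisfy $\varepsilon+2\sqrt\varepsilon+\varepsilon'<1$. Then $${}^1I_{\max}^{\varepsilon+2\sqrt\varepsilon+\varepsilon'}(A:B)_\rho\le H_{\max}^{\varepsilon'^2/48}(A)_\rho-H_{\min}^{\varepsilon'^2/48}(A|B)_\rho+g(\varepsilon)-l(\varepsilon'),$$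 where $$g(\varepsilon)=\log\left(\frac{2(1-\varepsilon)+3}{(1-\varepsilon)\left(1-\sqrt{1-\varepsilon^2}\right)}\right),\qquad l(\varepsilon')=2\log\frac{\varepsilon'^2}{24}.$$ -/

import Mathlib

open scoped MatrixOrder ComplexOrder Kronecker

noncomputable section

namespace MaxInfo

/-- `S_=(H)`: the normalized density operators on `H = ℂ^n`, as matrices in an orthonormal basis. -/
def states (n : Type*) [Fintype n] : Set (Matrix n n ℂ) :=
  {ρ | ρ.PosSemidef ∧ ρ.trace = 1}

/-- `S_≤(H)`: the subnormalized density operators, `ρ ≥ 0` with `0 < tr ρ ≤ 1`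
(the trace of a positive semidefinite matrix is real). -/
def subStates (n : Type*) [Fintype n] : Set (Matrix n n ℂ) :=
  {ρ | ρ.PosSemidef ∧ 0 < ρ.trace.re ∧ ρ.trace.re ≤ 1}

/-- The reduced operator `ρ_A = tr_B ρ_AB`. -/
def margA {A B : Type*} [Fintype B] (ρ : Matrix (A × B) (A × B) ℂ) : Matrix A A ℂ :=
  Matrix.of fun a a' => ∑ b, ρ (a, b) (a', b)

/-- The reduced operator `ρ_B = tr_A ρ_AB`. -/
def margB {A B : Type*} [Fintype A] (ρ : Matrix (A × B) (A × B) ℂ) : Matrix B B ℂ :=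
  Matrix.of fun b b' => ∑ a, ρ (a, b) (a, b')

/-- The trace norm `‖O‖₁ = tr √(O† O)`. -/
def traceNorm {n : Type*} [Fintype n] [DecidableEq n] (O : Matrix n n ℂ) : ℝ :=
  (CFC.sqrt (O.conjTranspose * O)).trace.re

/-- The generalized fidelity `F(ρ, σ) = ‖√ρ √σ‖₁ + √((1 - tr ρ)(1 - tr σ))`. -/
def fidelity {n : Type*} [Fintype n] [DecidableEq n] (ρ σ : Matrix n n ℂ) : ℝ :=
  traceNorm (CFC.sqrt ρ * CFC.sqrt σ) + √((1 - ρ.trace.re) * (1 - σ.trace.re))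

/-- The purified distance `P(ρ, σ) = √(1 - F(ρ, σ)²)`. -/
def purifiedDist {n : Type*} [Fintype n] [DecidableEq n] (ρ σ : Matrix n n ℂ) : ℝ :=
  √(1 - fidelity ρ σ ^ 2)

/-- The ball of subnormalized states that are `ε`-close to `ρ` in purified distance. -/
def epsBall {n : Type*} [Fintype n] [DecidableEq n] (ε : ℝ) (ρ : Matrix n n ℂ) :
    Set (Matrix n n ℂ) :=
  {ρ' | ρ' ∈ subStates n ∧ purifiedDist ρ ρ' ≤ ε}

/-- The max-relative entropy `D_max(ρ‖σ) = min {x | 2^x σ ≥ ρ}` (Loewner order),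
which is `+∞` when no such `x` exists. -/
def maxRelEntropy {n : Type*} [Fintype n] (ρ σ : Matrix n n ℂ) : EReal :=
  sInf {d : EReal | ∃ x : ℝ, d = (x : EReal) ∧ ρ ≤ ((2 : ℝ) ^ x) • σ}

/-- The conditional min-entropy
`H_min(A|B)_ρ = - min_{σ_B ∈ S_=(H_B)} D_max(ρ_AB ‖ 𝟙_A ⊗ σ_B)`. -/
def condMinEntropy {A B : Type*} [Fintype A] [DecidableEq A] [Fintype B]
    (ρ : Matrix (A × B) (A × B) ℂ) : EReal :=
  -(⨅ σ ∈ states B, maxRelEntropy ρ ((1 : Matrix A A ℂ) ⊗ₖ σ))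

/-- The smooth conditional min-entropy `H_min^ε(A|B)_ρ = max_{ρ' ∈ B^ε(ρ)} H_min(A|B)_ρ'`. -/
def smoothCondMinEntropy {A B : Type*} [Fintype A] [DecidableEq A] [Fintype B] [DecidableEq B]
    (ε : ℝ) (ρ : Matrix (A × B) (A × B) ℂ) : EReal :=
  ⨆ ρ' ∈ epsBall ε ρ, condMinEntropy ρ'

/-- The max-entropy `H_max(A)_ρ = log₂ ‖√ρ_A‖₁²`. -/
def maxEntropy {A : Type*} [Fintype A] [DecidableEq A] (ρ : Matrix A A ℂ) : ℝ :=
  Real.logb 2 (traceNorm (CFC.sqrt ρ) ^ 2)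

/-- The smooth max-entropy `H_max^ε(A)_ρ = min_{ρ' ∈ B^ε(ρ_A)} H_max(A)_ρ'`. -/
def smoothMaxEntropy {A : Type*} [Fintype A] [DecidableEq A] (ε : ℝ) (ρ : Matrix A A ℂ) : EReal :=
  ⨅ ρ' ∈ epsBall ε ρ, (maxEntropy ρ' : EReal)

/-- The max-information `¹I_max(A:B)_ρ = D_max(ρ_AB ‖ ρ_A ⊗ ρ_B)`. -/
def maxInfo₁ {A B : Type*} [Fintype A] [Fintype B] (ρ : Matrix (A × B) (A × B) ℂ) : EReal :=
  maxRelEntropy ρ (margA ρ ⊗ₖ margB ρ)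

/-- The smooth max-information `¹I_max^ε(A:B)_ρ = min_{ρ' ∈ B^ε(ρ)} ¹I_max(A:B)_ρ'`. -/
def smoothMaxInfo₁ {A B : Type*} [Fintype A] [DecidableEq A] [Fintype B] [DecidableEq B]
    (ε : ℝ) (ρ : Matrix (A × B) (A × B) ℂ) : EReal :=
  ⨅ ρ' ∈ epsBall ε ρ, maxInfo₁ ρ'

/-- `g(ε) = log₂ ((2(1-ε)+3) / ((1-ε)(1-√(1-ε²))))`. -/
def g (ε : ℝ) : ℝ :=
  Real.logb 2 ((2 * (1 - ε) + 3) / ((1 - ε) * (1 - √(1 - ε ^ 2))))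

/-- `l(ε) = 2 log₂ (ε²/24)`. -/
def l (ε : ℝ) : ℝ :=
  2 * Real.logb 2 (ε ^ 2 / 24)

end MaxInfo

end

open scoped MatrixOrder ComplexOrder Kronecker

namespace MaxInfo
open Matrix

set_option linter.unusedSectionVars false

/-! ### Hilbert–Schmidt calculus and functional calculus for positive matrices. -/

section Basic
variable {n m : Type*} [Fintype n] [DecidableEq n] [Fintype m] [DecidableEq m]

/-! A matrix `Y` with `Y * Yᴴ ≤ M` plays the role of a purification: the largest value of Re tr(√ρ
Y) over such `Y` is ‖√ρ √M‖₁ (`exists_amplitude`, `re_trace_le_traceNorm`). Fidelity estimates thus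
become Hilbert–Schmidt estimates on amplitudes.

Fix ρ₁ near ρ_A and ρ₂ near ρ with ρ₂ ≤ 2^x (1 ⊗ σ), and take an amplitude of ρ₂ close to √ρ. Two
operations on it turn 1 ⊗ σ into a product of the desired kind. On A, the eigenspaces of ρ₁ below s
are cut away; on the rest 1 ≤ ρ₁/s, and the lost weight is controlled by √s tr √ρ₁, so 1/s may be
taken of order 2^(H_max) (`exists_spectral_cut`, `hsSq_cut_le`). On B, a filter replaces σ by t⁻¹
times the filtered marginal, losing weight at most t (`exists_filter`).

The result satisfies τ ≤ L (α ⊗ τ_B) with α = ρ₁ / tr ρ₁, but τ_A need not dominate a multiple of α.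
Mixing in κ (α ⊗ τ_B) repairs this without changing the B-marginal (`mix_le_marginals`).
`exists_smoothed_state` combines these operations, `smoothMaxInfo₁_le` fixes s, t, κ, and the
corollary follows by optimising over ρ₁, ρ₂, σ and x. -/

theorem conj_le_conj (C : Matrix m n ℂ) {M N : Matrix n n ℂ} (h : M ≤ N) :
    C * M * Cᴴ ≤ C * N * Cᴴ := by
  rw [Matrix.le_iff] at *
  have := h.mul_mul_conjTranspose_same C
  rwa [Matrix.mul_sub, Matrix.sub_mul] at this

theorem trace_re_mono {M N : Matrix n n ℂ} (h : M ≤ N) : M.trace.re ≤ N.trace.re := by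
  have := (Matrix.le_iff.1 h).trace_nonneg
  rw [trace_sub, sub_nonneg] at this
  exact (Complex.le_def.1 this).1

theorem trace_re_nonneg {M : Matrix n n ℂ} (h : 0 ≤ M) : 0 ≤ M.trace.re := by
  simpa using trace_re_mono h

/-- The squared Hilbert–Schmidt norm. -/
noncomputable def hsSq (M : Matrix n m ℂ) : ℝ := (M * Mᴴ).trace.re

theorem mul_conjTranspose_nonneg (M : Matrix n m ℂ) : 0 ≤ M * Mᴴ :=
  (posSemidef_self_mul_conjTranspose M).nonneg

theorem hsSq_nonneg (M : Matrix n m ℂ) : 0 ≤ hsSq M :=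
  trace_re_nonneg (mul_conjTranspose_nonneg M)

theorem trace_conjTranspose_re (M : Matrix n n ℂ) : (Mᴴ).trace.re = M.trace.re := by
  rw [trace_conjTranspose]; simp

theorem hsSq_add (M N : Matrix n m ℂ) :
    hsSq (M + N) = hsSq M + 2 * (M * Nᴴ).trace.re + hsSq N := by
  have h : (N * Mᴴ).trace.re = (M * Nᴴ).trace.re := by
    rw [← trace_conjTranspose_re]; simp
  simp only [hsSq, conjTranspose_add, Matrix.add_mul, Matrix.mul_add, trace_add, Complex.add_re, h]
  ring

theorem hsSq_smul (r : ℝ) (M : Matrix n m ℂ) : hsSq (r • M) = r ^ 2 * hsSq M := by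
  simp [hsSq, conjTranspose_smul, trace_smul]
  ring

theorem hsSq_sub (M N : Matrix n m ℂ) :
    hsSq (M - N) = hsSq M - 2 * (M * Nᴴ).trace.re + hsSq N := by
  have h := hsSq_add M ((-1 : ℝ) • N)
  rw [hsSq_smul] at h
  have e : M + (-1 : ℝ) • N = M - N := by simp [sub_eq_add_neg]
  rw [e] at h
  rw [h]
  simp [trace_neg]
  ring

/-- Expand ‖M/2 - 2N‖² ≥ 0. The unequal weights keep the factor on the main term `M` near 1, at the
expense of the error term `N`. -/
theorem hsSq_add_le (M N : Matrix n m ℂ) : hsSq (M + N) ≤ 5 / 4 * hsSq M + 5 * hsSq N := by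
  have h := hsSq_nonneg ((1 / 2 : ℝ) • M - (2 : ℝ) • N)
  rw [hsSq_sub, hsSq_smul, hsSq_smul] at h
  have e : ((1 / 2 : ℝ) • M * ((2 : ℝ) • N)ᴴ) = M * Nᴴ := by
    rw [conjTranspose_smul, Matrix.smul_mul, Matrix.mul_smul, smul_smul]; norm_num
  rw [e] at h
  rw [hsSq_add]
  linarith

theorem hsSq_add_add_le (M N K : Matrix n m ℂ) :
    hsSq (M + N + K) ≤ 3 * (hsSq M + hsSq N + hsSq K) := by
  have h1 := hsSq_nonneg (M - N)
  have h2 := hsSq_nonneg (M - K)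
  have h3 := hsSq_nonneg (N - K)
  rw [hsSq_sub] at h1 h2 h3
  rw [hsSq_add, hsSq_add, Matrix.add_mul, trace_add, Complex.add_re]
  linarith

theorem continuousOn_spectrum (f : ℝ → ℝ) (M : Matrix n n ℂ) : ContinuousOn f (spectrum ℝ M) :=
  M.finite_real_spectrum.continuousOn f

theorem cfc_mul_cfc (f g : ℝ → ℝ) (M : Matrix n n ℂ) :
    cfc f M * cfc g M = cfc (fun x => f x * g x) M :=
  (cfc_mul f g M (continuousOn_spectrum f M) (continuousOn_spectrum g M)).symm

theorem cfc_mul_self (f : ℝ → ℝ) {M : Matrix n n ℂ} (hM : 0 ≤ M) :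
    cfc f M * M = cfc (fun x => f x * x) M := by
  conv_lhs => rhs; rw [← cfc_id' ℝ M hM.isSelfAdjoint]
  exact cfc_mul_cfc _ _ _

theorem cfc_conjTranspose (f : ℝ → ℝ) (M : Matrix n n ℂ) : (cfc f M)ᴴ = cfc f M :=
  (cfc_predicate f M : IsSelfAdjoint _)

theorem cfc_le_cfc {f g : ℝ → ℝ} {M : Matrix n n ℂ} (hM : 0 ≤ M)
    (h : ∀ x, 0 ≤ x → f x ≤ g x) : cfc f M ≤ cfc g M :=
  cfc_mono (fun x hx => h x (spectrum_nonneg_of_nonneg hM hx))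
    (continuousOn_spectrum f M) (continuousOn_spectrum g M)

theorem cfc_congr_nonneg {f g : ℝ → ℝ} {M : Matrix n n ℂ} (hM : 0 ≤ M)
    (h : ∀ x, 0 ≤ x → f x = g x) : cfc f M = cfc g M :=
  cfc_congr fun x hx => h x (spectrum_nonneg_of_nonneg hM hx)

theorem cfc_zero_le {f : ℝ → ℝ} {M : Matrix n n ℂ} (hM : 0 ≤ M)
    (h : ∀ x, 0 ≤ x → 0 ≤ f x) : 0 ≤ cfc f M :=
  cfc_nonneg fun x hx => h x (spectrum_nonneg_of_nonneg hM hx)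

theorem sqrt_eq_cfc_sqrt {M : Matrix n n ℂ} (hM : 0 ≤ M) :
    CFC.sqrt M = cfc Real.sqrt M := by
  apply CFC.sqrt_unique
  · rw [cfc_mul_cfc]
    conv_rhs => rw [← cfc_id' ℝ M hM.isSelfAdjoint]
    exact cfc_congr_nonneg hM fun x hx => Real.mul_self_sqrt hx
  · exact cfc_zero_le hM fun x _ => Real.sqrt_nonneg x

theorem sqrt_conjTranspose (M : Matrix n n ℂ) : (CFC.sqrt M)ᴴ = CFC.sqrt M :=
  (CFC.sqrt_nonneg M).isSelfAdjoint

/-- The square root of a positive semidefinite matrix, with its pseudo-inverse. -/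
theorem exists_pseudoInverse {M : Matrix n n ℂ} (hM : 0 ≤ M) :
    ∃ T P : Matrix n n ℂ, Tᴴ = T ∧ Pᴴ = P ∧ 0 ≤ P ∧ P ≤ 1 ∧ P * P = P ∧
      CFC.sqrt M * T = P ∧ T * CFC.sqrt M = P ∧ P * CFC.sqrt M = CFC.sqrt M ∧
      CFC.sqrt M * P = CFC.sqrt M ∧ P * T = T ∧ T * P = T := by
  have h1 : ∀ x : ℝ, 0 ≤ x → √x * (√x)⁻¹ = if 0 < x then 1 else 0 := fun x hx => by
    split_ifs with h
    · exact mul_inv_cancel₀ (Real.sqrt_pos.2 h).ne'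
    · rw [le_antisymm (not_lt.1 h) hx]; simp
  have h2 : ∀ x : ℝ, 0 ≤ x → ¬ 0 < x → √x = 0 := fun x hx h => by
    rw [le_antisymm (not_lt.1 h) hx]; simp
  -- The convention 0⁻¹ = 0 makes the first witness a pseudo-inverse; the second is the support
  -- projection.
  refine ⟨cfc (fun x => (√x)⁻¹) M, cfc (fun x => if 0 < x then 1 else 0) M,
    cfc_conjTranspose _ _, cfc_conjTranspose _ _, ?_, ?_, ?_, ?_, ?_, ?_, ?_, ?_, ?_⟩
  · exact cfc_zero_le hM fun x _ => by split_ifs <;> norm_num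
  · exact cfc_le_one _ _ fun x _ => by split_ifs <;> norm_num
  all_goals
    simp only [sqrt_eq_cfc_sqrt hM, cfc_mul_cfc]
    refine cfc_congr_nonneg hM fun x hx => ?_
  · split_ifs <;> norm_num
  · exact h1 x hx
  · rw [mul_comm]; exact h1 x hx
  all_goals
    split_ifs with h
    · simp
    · simp [h2 x hx h]

end Basic

/-! ### Variational formula for the trace norm, and filtering. -/

section Amplitudes
variable {n m : Type*} [Fintype n] [DecidableEq n] [Fintype m] [DecidableEq m]

theorem eq_mul_of_conjTranspose_mul_self {M : Matrix n m ℂ} {P : Matrix m m ℂ} (hP : Pᴴ = P)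
    (h : Mᴴ * M * P = Mᴴ * M) : M * P = M := by
  have h0 : (M * (1 - P))ᴴ * (M * (1 - P)) = 0 := by
    have : (M * (1 - P))ᴴ * (M * (1 - P)) = (1 - P) * (Mᴴ * M - Mᴴ * M * P) := by
      rw [conjTranspose_mul, conjTranspose_sub, conjTranspose_one, hP]
      simp only [Matrix.mul_sub, Matrix.sub_mul, Matrix.mul_one, Matrix.one_mul, Matrix.mul_assoc]
    rw [this, h, sub_self, mul_zero]
  have h1 := conjTranspose_mul_self_eq_zero.1 h0
  rw [Matrix.mul_sub, Matrix.mul_one, sub_eq_zero] at h1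
  exact h1.symm

/-- Conjugation by `1 - P` annihilates `M`, hence also the smaller `W * Wᴴ`. -/
theorem eq_mul_of_mul_conjTranspose_le {W : Matrix n m ℂ} {M P : Matrix n n ℂ}
    (hM : P * M = M) (hW : W * Wᴴ ≤ M) : P * W = W := by
  have h := conj_le_conj (1 - P) hW
  have e : (1 - P) * M * (1 - P)ᴴ = 0 := by
    rw [Matrix.sub_mul, hM, one_mul, sub_self, zero_mul]
  have e' : (1 - P) * (W * Wᴴ) * (1 - P)ᴴ = ((1 - P) * W) * ((1 - P) * W)ᴴ := by
    rw [conjTranspose_mul]; simp only [Matrix.mul_assoc]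
  rw [e, e'] at h
  have h1 := self_mul_conjTranspose_eq_zero.1 (le_antisymm h (mul_conjTranspose_nonneg _))
  rw [Matrix.sub_mul, Matrix.one_mul, sub_eq_zero] at h1
  exact h1.symm

/-- Polar decomposition: with `O = R√M` and `T` the pseudo-inverse of |O|, the factor `O * T` is a
partial isometry, and its adjoint, multiplied by √M on the left, is the optimal amplitude. -/
theorem exists_amplitude (R : Matrix n n ℂ) {M : Matrix n n ℂ} (hM : 0 ≤ M) :
    ∃ Y : Matrix n n ℂ, Y * Yᴴ ≤ M ∧ (R * Y).trace.re = traceNorm (R * CFC.sqrt M) := by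
  obtain ⟨O, hO⟩ : ∃ O, O = R * CFC.sqrt M := ⟨_, rfl⟩
  rw [← hO]
  have hD : 0 ≤ Oᴴ * O := (posSemidef_conjTranspose_mul_self O).nonneg
  obtain ⟨T, P, hT, -, -, hP1, hPP, hST, hTS, hPS, -⟩ := exists_pseudoInverse hD
  have hSS := CFC.sqrt_mul_sqrt_self (Oᴴ * O) hD
  obtain ⟨S, hS⟩ : ∃ S, S = CFC.sqrt (Oᴴ * O) := ⟨_, rfl⟩
  rw [← hS] at hST hTS hPS hSS
  refine ⟨CFC.sqrt M * (T * Oᴴ), ?_, ?_⟩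
  · have e : CFC.sqrt M * (T * Oᴴ) * (CFC.sqrt M * (T * Oᴴ))ᴴ
        = CFC.sqrt M * P * (CFC.sqrt M)ᴴ := by
      have : (T * Oᴴ) * (T * Oᴴ)ᴴ = P := by
        rw [conjTranspose_mul, conjTranspose_conjTranspose, hT, Matrix.mul_assoc,
          ← Matrix.mul_assoc Oᴴ, ← hSS, Matrix.mul_assoc, hST, ← Matrix.mul_assoc, hTS, hPP]
      rw [conjTranspose_mul, ← Matrix.mul_assoc, Matrix.mul_assoc (CFC.sqrt M), this]
    rw [e]
    have h := conj_le_conj (CFC.sqrt M) hP1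
    rw [mul_one, sqrt_conjTranspose, CFC.sqrt_mul_sqrt_self M hM] at h
    rwa [sqrt_conjTranspose]
  · rw [traceNorm, ← hS, ← Matrix.mul_assoc, ← hO, trace_mul_comm, Matrix.mul_assoc, ← hSS,
      ← Matrix.mul_assoc, hTS, hPS]

/-- Write `W` as √M times a contraction and `R√M` as a partial isometry times its absolute value
`S`; Cauchy–Schwarz with `S` split into two square roots gives the bound. -/
theorem re_trace_le_traceNorm (R : Matrix n n ℂ) {M W : Matrix n n ℂ} (hW : W * Wᴴ ≤ M) :
    (R * W).trace.re ≤ traceNorm (R * CFC.sqrt M) := by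
  have hM : 0 ≤ M := (mul_conjTranspose_nonneg W).trans hW
  obtain ⟨O, hO⟩ : ∃ O, O = R * CFC.sqrt M := ⟨_, rfl⟩
  rw [← hO]
  have hD : 0 ≤ Oᴴ * O := (posSemidef_conjTranspose_mul_self O).nonneg
  obtain ⟨T, P, hT, hP, -, hP1, hPP, hST, hTS, hPS, hSP, hPT, hTP⟩ := exists_pseudoInverse hD
  obtain ⟨T', P', hT', hP', -, hP1', hPP', hST', hTS', hPS', -⟩ := exists_pseudoInverse hM
  have hSS := CFC.sqrt_mul_sqrt_self (Oᴴ * O) hD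
  have hSS' := CFC.sqrt_mul_sqrt_self M hM
  have hPW : P' * W = W :=
    eq_mul_of_mul_conjTranspose_le (by rw [← hSS', ← Matrix.mul_assoc, hPS']) hW
  have hOP : O * P = O :=
    eq_mul_of_conjTranspose_mul_self hP (by rw [← hSS, Matrix.mul_assoc, hSP])
  set S := CFC.sqrt (Oᴴ * O) with hS
  have hS0 : 0 ≤ S := CFC.sqrt_nonneg _
  set h := CFC.sqrt S
  have hh : h * h = S := CFC.sqrt_mul_sqrt_self S hS0
  have hhc : hᴴ = h := sqrt_conjTranspose S
  have hC : (T' * W) * (T' * W)ᴴ ≤ 1 := by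
    have h1 := conj_le_conj T' hW
    have e : T' * M * T'ᴴ = P' := by
      rw [hT', ← hSS', ← Matrix.mul_assoc, hTS', Matrix.mul_assoc, hST', hPP']
    rw [e] at h1
    refine le_trans (le_of_eq ?_) (h1.trans hP1')
    rw [conjTranspose_mul]; simp only [Matrix.mul_assoc]
  have hK : (O * T)ᴴ * (O * T) ≤ 1 := by
    have e : (O * T)ᴴ * (O * T) = P := by
      rw [conjTranspose_mul, hT, Matrix.mul_assoc, ← Matrix.mul_assoc Oᴴ, ← hSS, Matrix.mul_assoc,
        hST, ← Matrix.mul_assoc, hTS, hPP]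
    rwa [e]
  have e1 : (R * W).trace = (h * (T' * W) * (h * (O * T)ᴴ)ᴴ).trace := by
    have e : O * T * S = O := by rw [Matrix.mul_assoc, hTS, hOP]
    have e' : R * W = O * (T' * W) := by
      rw [hO, Matrix.mul_assoc, ← Matrix.mul_assoc (CFC.sqrt M), hST', hPW]
    rw [conjTranspose_mul, conjTranspose_conjTranspose, hhc, Matrix.mul_assoc h, trace_mul_comm h,
      Matrix.mul_assoc, Matrix.mul_assoc (O * T), hh, e, e', trace_mul_comm]
  have e2 : hsSq (h * (T' * W)) ≤ S.trace.re := by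
    have h1 := trace_re_mono (conj_le_conj h hC)
    rw [hhc, mul_one, hh] at h1
    refine le_trans (le_of_eq ?_) h1
    rw [hsSq, conjTranspose_mul h, hhc]; simp only [Matrix.mul_assoc]
  have e3 : hsSq (h * (O * T)ᴴ) ≤ S.trace.re := by
    have h1 := trace_re_mono (conj_le_conj h hK)
    rw [hhc, mul_one, hh] at h1
    refine le_trans (le_of_eq ?_) h1
    rw [hsSq, conjTranspose_mul h, hhc, conjTranspose_conjTranspose]; simp only [Matrix.mul_assoc]
  have e4 := hsSq_nonneg (h * (T' * W) - h * (O * T)ᴴ)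
  rw [hsSq_sub, ← e1] at e4
  rw [traceNorm, ← hS]
  linarith

/-- Filtering on a reference operator `σ` turns it into a multiple of the filtered marginal. -/
theorem exists_filter {β σ : Matrix n n ℂ} (hβ : 0 ≤ β) (hσ : 0 ≤ σ) (hσ1 : σ.trace.re ≤ 1)
    {t : ℝ} (ht : 0 < t) :
    ∃ G : Matrix n n ℂ, G * σ * Gᴴ ≤ t⁻¹ • (G * β * Gᴴ) ∧
      (G * β * Gᴴ).trace.re = (G * β).trace.re ∧ β.trace.re - (G * β).trace.re ≤ t := by
  obtain ⟨T, P, hT, hP, hP0, hP1, hPP, hST, hTS, hPS, hSP, hPT, hTP⟩ := exists_pseudoInverse hβ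
  have hSS := CFC.sqrt_mul_sqrt_self β hβ
  have hS := sqrt_conjTranspose β
  set S := CFC.sqrt β
  set X := T * σ * T with hX
  have hX0 : 0 ≤ X := by
    have := conj_le_conj T hσ
    simpa [hT] using this
  -- `Q` is the spectral projection of β^(-1/2) σ β^(-1/2) on which σ is at most t⁻¹ β, after
  -- rescaling by β.
  set f : ℝ → ℝ := fun x => if x ≤ t⁻¹ then 1 else 0 with hf
  set Q := cfc f X with hQ
  have hQc : Qᴴ = Q := cfc_conjTranspose _ _
  have hXc : IsSelfAdjoint X := hX0.isSelfAdjoint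
  have hPX : Commute X P := by
    rw [commute_iff_eq, hX, Matrix.mul_assoc, hTP, ← Matrix.mul_assoc, ← Matrix.mul_assoc, hPT]
  have hPQ : Q * P = P * Q := (hXc.commute_cfc hPX f).eq
  have hQX : Q * X * Q ≤ t⁻¹ • Q := by
    rw [hQ, cfc_mul_self _ hX0, cfc_mul_cfc, ← cfc_smul t⁻¹ f X (continuousOn_spectrum _ _)]
    refine cfc_le_cfc hX0 fun x hx => ?_
    simp only [hf]
    split_ifs with h
    · simpa using h
    · simp
  have hQQ : Q * Q = Q := by
    rw [hQ, cfc_mul_cfc]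
    exact cfc_congr_nonneg hX0 fun x hx => by simp only [hf]; split_ifs <;> simp
  -- Markov's inequality: the indicator of x > t⁻¹ is at most t x.
  have h1Q : 1 - Q ≤ t • X := by
    have e : 1 - Q = cfc (fun x => 1 - f x) X := by
      rw [cfc_sub (fun _ => 1) f X (continuousOn_spectrum _ _) (continuousOn_spectrum _ _),
        cfc_const_one ℝ X hXc]
    have e' : t • X = cfc (fun x => t * x) X := (cfc_const_mul_id t X hXc).symm
    rw [e, e']
    refine cfc_le_cfc hX0 fun x hx => ?_
    simp only [hf]
    split_ifs with h
    · simp; positivity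
    · rw [not_le, inv_lt_iff_one_lt_mul₀' ht] at h
      linarith
  have hG : (S * Q * T)ᴴ = T * Q * S := by
    rw [conjTranspose_mul, conjTranspose_mul, hS, hT, hQc, Matrix.mul_assoc]
  have hSQS : S * Q * T * β * (T * Q * S) = S * Q * S := by
    calc S * Q * T * β * (T * Q * S) = S * Q * (T * S) * (S * T) * Q * S := by
          rw [← hSS]; simp only [Matrix.mul_assoc]
      _ = S * (Q * P) * P * Q * S := by rw [hTS, hST]; simp only [Matrix.mul_assoc]
      _ = S * P * (Q * P) * Q * S := by
          conv_lhs => rw [hPQ]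
          simp only [Matrix.mul_assoc]
      _ = S * P * P * Q * Q * S := by rw [hPQ]; simp only [Matrix.mul_assoc]
      _ = S * Q * S := by rw [hSP, hSP, Matrix.mul_assoc S, hQQ]
  have hGβ : (S * Q * T * β).trace = (S * Q * S).trace := by
    calc (S * Q * T * β).trace = (S * Q * (T * S) * S).trace := by
          rw [← hSS]; simp only [Matrix.mul_assoc]
      _ = (S * Q * S).trace := by rw [hTS, Matrix.mul_assoc _ P, hPS]
  -- The filter is β^(1/2) Q β^(-1/2), so both G β Gᴴ and G β have the trace of β^(1/2) Q β^(1/2).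
  refine ⟨S * Q * T, ?_, ?_, ?_⟩
  · rw [hG, hSQS]
    have h := conj_le_conj S hQX
    rw [hS, Matrix.mul_smul, Matrix.smul_mul] at h
    refine le_trans (le_of_eq ?_) h
    rw [hX]; simp only [Matrix.mul_assoc]
  · rw [hG, hSQS, hGβ]
  · rw [hGβ]
    have h := trace_re_mono (conj_le_conj S h1Q)
    rw [hS, Matrix.mul_sub, Matrix.sub_mul, mul_one, hSS, trace_sub, Complex.sub_re] at h
    refine h.trans ?_
    have e : S * (t • X) * S = t • (P * σ * P) := by
      rw [Matrix.mul_smul, Matrix.smul_mul, hX, ← hST]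
      congr 1
      conv_rhs => rhs; rw [hST, ← hTS]
      simp only [Matrix.mul_assoc]
    have h2 : (P * σ * P).trace.re ≤ σ.trace.re := by
      have h3 := trace_re_mono (conj_le_conj (CFC.sqrt σ) hP1)
      rw [sqrt_conjTranspose, mul_one, CFC.sqrt_mul_sqrt_self σ hσ, trace_mul_comm,
        ← Matrix.mul_assoc, CFC.sqrt_mul_sqrt_self σ hσ] at h3
      rwa [trace_mul_comm, ← Matrix.mul_assoc, hPP, trace_mul_comm]
    rw [e, trace_smul, Complex.smul_re, smul_eq_mul]
    nlinarith

end Amplitudes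

/-! ### Partial traces and Kronecker products. -/

section Marginals
variable {A B : Type*} [Fintype A] [DecidableEq A] [Fintype B] [DecidableEq B]

theorem margA_add (M N : Matrix (A × B) (A × B) ℂ) : margA (M + N) = margA M + margA N := by
  ext; simp [margA, Finset.sum_add_distrib]

theorem margB_add (M N : Matrix (A × B) (A × B) ℂ) : margB (M + N) = margB M + margB N := by
  ext; simp [margB, Finset.sum_add_distrib]

theorem margA_smul (r : ℝ) (M : Matrix (A × B) (A × B) ℂ) : margA (r • M) = r • margA M := by
  ext; simp [margA, Finset.mul_sum]

theorem margB_smul (r : ℝ) (M : Matrix (A × B) (A × B) ℂ) : margB (r • M) = r • margB M := by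
  ext; simp [margB, Finset.mul_sum]

theorem margA_kronecker (M : Matrix A A ℂ) (N : Matrix B B ℂ) :
    margA (M ⊗ₖ N) = N.trace • M := by
  ext; simp [margA, trace, ← Finset.mul_sum, mul_comm]

theorem margB_kronecker (M : Matrix A A ℂ) (N : Matrix B B ℂ) :
    margB (M ⊗ₖ N) = M.trace • N := by
  ext; simp [margB, trace, ← Finset.sum_mul]

theorem trace_margA (M : Matrix (A × B) (A × B) ℂ) : (margA M).trace = M.trace := by
  simp [margA, trace, Fintype.sum_prod_type]

theorem trace_margB (M : Matrix (A × B) (A × B) ℂ) : (margB M).trace = M.trace := by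
  simp [margB, trace, Fintype.sum_prod_type_right]

theorem margA_nonneg {M : Matrix (A × B) (A × B) ℂ} (hM : 0 ≤ M) : 0 ≤ margA M := by
  have e : margA M = ∑ b, M.submatrix (fun a => (a, b)) (fun a => (a, b)) := by
    ext a a'; simp [margA, Matrix.sum_apply]
  rw [e]
  exact Finset.sum_nonneg fun b _ => ((nonneg_iff_posSemidef.1 hM).submatrix _).nonneg

theorem margB_nonneg {M : Matrix (A × B) (A × B) ℂ} (hM : 0 ≤ M) : 0 ≤ margB M := by
  have e : margB M = ∑ a, M.submatrix (fun b => (a, b)) (fun b => (a, b)) := by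
    ext a a'; simp [margB, Matrix.sum_apply]
  rw [e]
  exact Finset.sum_nonneg fun b _ => ((nonneg_iff_posSemidef.1 hM).submatrix _).nonneg

theorem margA_conj (E : Matrix A A ℂ) (M : Matrix (A × B) (A × B) ℂ) :
    margA ((E ⊗ₖ (1 : Matrix B B ℂ)) * M * (E ⊗ₖ (1 : Matrix B B ℂ))ᴴ)
      = E * margA M * Eᴴ := by
  ext a a'
  simp [margA, mul_apply, Fintype.sum_prod_type, one_apply, Finset.sum_mul, Finset.mul_sum,
    conjTranspose_kronecker]
  rw [Finset.sum_comm]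
  refine Finset.sum_congr rfl fun _ _ => ?_
  rw [Finset.sum_comm]

theorem margB_conj (G : Matrix B B ℂ) (M : Matrix (A × B) (A × B) ℂ) :
    margB (((1 : Matrix A A ℂ) ⊗ₖ G) * M * ((1 : Matrix A A ℂ) ⊗ₖ G)ᴴ)
      = G * margB M * Gᴴ := by
  ext a a'
  simp [margB, mul_apply, Fintype.sum_prod_type, one_apply, Finset.sum_mul, Finset.mul_sum,
    conjTranspose_kronecker]
  rw [Finset.sum_comm]
  refine Finset.sum_congr rfl fun _ _ => ?_
  rw [Finset.sum_comm]

theorem trace_one_kronecker_mul (G : Matrix B B ℂ) (M : Matrix (A × B) (A × B) ℂ) :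
    (((1 : Matrix A A ℂ) ⊗ₖ G) * M).trace = (G * margB M).trace := by
  simp [margB, trace, mul_apply, Fintype.sum_prod_type, one_apply, Finset.mul_sum]
  rw [Finset.sum_comm]
  refine Finset.sum_congr rfl fun _ _ => ?_
  rw [Finset.sum_comm]

theorem kronecker_mono_left {M M' : Matrix A A ℂ} {N : Matrix B B ℂ} (h : M ≤ M') (hN : 0 ≤ N) :
    M ⊗ₖ N ≤ M' ⊗ₖ N := by
  have e : M' ⊗ₖ N - M ⊗ₖ N = (M' - M) ⊗ₖ N := by
    ext; simp [sub_mul]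
  rw [← sub_nonneg, e]
  exact ((Matrix.le_iff.1 h).kronecker (nonneg_iff_posSemidef.1 hN)).nonneg

theorem kronecker_mono_right {M : Matrix A A ℂ} {N N' : Matrix B B ℂ} (hM : 0 ≤ M) (h : N ≤ N') :
    M ⊗ₖ N ≤ M ⊗ₖ N' := by
  have e : M ⊗ₖ N' - M ⊗ₖ N = M ⊗ₖ (N' - N) := by
    ext; simp [mul_sub]
  rw [← sub_nonneg, e]
  exact ((nonneg_iff_posSemidef.1 hM).kronecker (Matrix.le_iff.1 h)).nonneg

end Marginals

/-! ### Spectral cut, close amplitudes and mixing. -/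

section Smoothing
variable {n m : Type*} [Fintype n] [DecidableEq n] [Fintype m] [DecidableEq m]

/-- `E` projects onto the eigenvalues x < s, where x ≤ √s √x; this is how tr √M, and with it the
max-entropy, enters. -/
theorem exists_spectral_cut {M : Matrix n n ℂ} (hM : 0 ≤ M) {s : ℝ} (hs : 0 < s) :
    ∃ E : Matrix n n ℂ, Eᴴ = E ∧ E * E = E ∧ s • (1 - E) ≤ M ∧
      (E * M * Eᴴ).trace.re ≤ √s * (CFC.sqrt M).trace.re := by
  have hMc : IsSelfAdjoint M := hM.isSelfAdjoint
  set f : ℝ → ℝ := fun x => if x < s then 1 else 0 with hf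
  have hEc := cfc_conjTranspose f M
  refine ⟨cfc f M, hEc, ?_, ?_, ?_⟩
  · rw [cfc_mul_cfc]
    exact cfc_congr_nonneg hM fun x _ => by simp only [hf]; split_ifs <;> simp
  · have e : s • (1 - cfc f M) = cfc (fun x => s * (1 - f x)) M := by
      rw [cfc_const_mul s (fun x => 1 - f x) M (continuousOn_spectrum _ _),
        cfc_sub (fun _ => 1) f M (continuousOn_spectrum _ _) (continuousOn_spectrum _ _),
        cfc_const_one ℝ M hMc]
    rw [e]
    conv_rhs => rw [← cfc_id' ℝ M hMc]
    refine cfc_le_cfc hM fun x hx => ?_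
    simp only [hf]
    split_ifs with h
    · simpa using hx
    · simpa using h
  · have e : √s * (CFC.sqrt M).trace.re = (√s • CFC.sqrt M).trace.re := by
      simp [trace_smul]
    rw [hEc, cfc_mul_self f hM, cfc_mul_cfc, e, sqrt_eq_cfc_sqrt hM,
      ← cfc_smul _ _ M (continuousOn_spectrum _ _)]
    refine trace_re_mono (cfc_le_cfc hM fun x hx => ?_)
    simp only [hf, smul_eq_mul]
    split_ifs with h
    · calc 1 * x * 1 = √x * √x := by rw [Real.mul_self_sqrt hx]; ring
        _ ≤ √s * √x := by gcongr
    · simp; positivity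

theorem traceNorm_sqrt (M : Matrix n n ℂ) : traceNorm (CFC.sqrt M) = (CFC.sqrt M).trace.re := by
  rw [traceNorm, sqrt_conjTranspose, CFC.sqrt_mul_self _ (CFC.sqrt_nonneg M)]

theorem traceNorm_nonneg (M : Matrix n n ℂ) : 0 ≤ traceNorm M :=
  trace_re_nonneg (CFC.sqrt_nonneg _)

theorem fidelity_of_state {ρ : Matrix n n ℂ} (hρ : ρ ∈ states n) (M : Matrix n n ℂ) :
    fidelity ρ M = traceNorm (CFC.sqrt ρ * CFC.sqrt M) := by
  simp [fidelity, hρ.2]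

theorem hsSq_sqrt {M : Matrix n n ℂ} (hM : 0 ≤ M) : hsSq (CFC.sqrt M) = M.trace.re := by
  rw [hsSq, sqrt_conjTranspose, CFC.sqrt_mul_sqrt_self M hM]

theorem hsSq_sub_comm (M N : Matrix n m ℂ) : hsSq (M - N) = hsSq (N - M) := by
  rw [← neg_sub N M, hsSq, hsSq, conjTranspose_neg, Matrix.neg_mul, Matrix.mul_neg, neg_neg]

theorem hsSq_mul_proj {E : Matrix n n ℂ} (hE : Eᴴ = E) (hEE : E * E = E) (M : Matrix n m ℂ) :
    hsSq (E * M) + hsSq ((1 - E) * M) = hsSq M := by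
  have h1 : ∀ F : Matrix n n ℂ, Fᴴ = F → F * F = F → hsSq (F * M) = (F * (M * Mᴴ)).trace.re := by
    intro F hF hFF
    rw [hsSq, conjTranspose_mul, hF, ← Matrix.mul_assoc, trace_mul_comm, ← Matrix.mul_assoc,
      ← Matrix.mul_assoc, hFF, Matrix.mul_assoc]
  rw [h1 E hE hEE, h1 (1 - E) (by simp [hE]) (by simp [Matrix.mul_sub, Matrix.sub_mul, hEE]),
    Matrix.sub_mul, one_mul, trace_sub, Complex.sub_re, hsSq]
  ring

theorem hsSq_mul_proj_le {E : Matrix n n ℂ} (hE : Eᴴ = E) (hEE : E * E = E) (M : Matrix n m ℂ) :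
    hsSq (E * M) ≤ hsSq M := by
  have := hsSq_mul_proj hE hEE M
  have := hsSq_nonneg ((1 - E) * M)
  linarith

theorem hsSq_mul_eq (E : Matrix n n ℂ) (M : Matrix n m ℂ) :
    hsSq (E * M) = (E * (M * Mᴴ) * Eᴴ).trace.re := by
  rw [hsSq, conjTranspose_mul]; simp only [Matrix.mul_assoc]

/-- The optimal `Y` has overlap F ≥ F² ≥ 1 - η² with √ρ (for F ≤ 1), and ‖√ρ - Y‖² = 1 - 2F + ‖Y‖²,
where 0 ≤ ‖Y‖² ≤ 1. -/
theorem exists_close_amplitude {ρ M : Matrix n n ℂ} (hρ : ρ ∈ states n) {η : ℝ} (hη : 0 ≤ η)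
    (hM : M ∈ epsBall η ρ) :
    ∃ Y : Matrix n n ℂ, Y * Yᴴ ≤ M ∧ hsSq (CFC.sqrt ρ - Y) ≤ 2 * η ^ 2 ∧
      1 - 2 * η ^ 2 ≤ hsSq Y := by
  obtain ⟨⟨hM0, -, hM1⟩, hP⟩ := hM
  obtain ⟨Y, hY, hF⟩ := exists_amplitude (CFC.sqrt ρ) hM0.nonneg
  rw [← fidelity_of_state hρ] at hF
  have hF0 : 0 ≤ fidelity ρ M := by rw [fidelity_of_state hρ]; exact traceNorm_nonneg _
  have hF2 : 1 - η ^ 2 ≤ fidelity ρ M ^ 2 := by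
    have := (Real.sqrt_le_left hη).1 hP
    linarith
  have hF1 : 1 - η ^ 2 ≤ fidelity ρ M := by
    by_contra! h
    nlinarith [sq_nonneg η]
  have hY1 : hsSq Y ≤ 1 := (trace_re_mono hY).trans hM1
  have hX : hsSq (CFC.sqrt ρ) = 1 := by rw [hsSq_sqrt hρ.1.nonneg, hρ.2]; simp
  have hXY : (CFC.sqrt ρ * Yᴴ).trace.re = fidelity ρ M := by
    rw [← hF, ← trace_conjTranspose_re, conjTranspose_mul, conjTranspose_conjTranspose,
      sqrt_conjTranspose, trace_mul_comm]
  have h := hsSq_sub (CFC.sqrt ρ) Y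
  rw [hX, hXY] at h
  have h0 := hsSq_nonneg (CFC.sqrt ρ - Y)
  exact ⟨Y, hY, by linarith, by linarith⟩

theorem ofReal_trace_re {M : Matrix n n ℂ} (hM : 0 ≤ M) : M.trace = (M.trace.re : ℂ) := by
  have h := (nonneg_iff_posSemidef.1 hM).trace_nonneg
  exact Complex.ext rfl (by simpa using (Complex.le_def.1 h).2.symm)

variable {A B : Type*} [Fintype A] [DecidableEq A] [Fintype B] [DecidableEq B]

/-- Mixing in a small product state turns an operator bound by a product with the right
`B`-marginal into a bound by the product of both marginals. -/
theorem mix_le_marginals {τ : Matrix (A × B) (A × B) ℂ} (hτ : 0 ≤ τ) {α : Matrix A A ℂ}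
    (hα : α ∈ states A) {L κ : ℝ} (hκ : 0 < κ) (hκ1 : κ ≤ 1) (hL : 1 ≤ L)
    (h : τ ≤ L • (α ⊗ₖ margB τ)) (hc : 1 / 2 ≤ τ.trace.re) :
    let ρ' := (1 - κ) • τ + κ • (α ⊗ₖ margB τ)
    0 ≤ ρ' ∧ (1 - κ) • τ ≤ ρ' ∧ ρ'.trace.re = τ.trace.re ∧
      ρ' ≤ (2 * L / κ) • (margA ρ' ⊗ₖ margB ρ') := by
  intro ρ'
  have hα0 : 0 ≤ α := hα.1.nonneg
  have hβ : 0 ≤ margB τ := margB_nonneg hτ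
  have hαβ : 0 ≤ α ⊗ₖ margB τ := by
    simpa using kronecker_mono_left hα0 hβ
  have hc' := ofReal_trace_re hτ
  have hB : margB ρ' = margB τ := by
    simp only [ρ', margB_add, margB_smul, margB_kronecker, hα.2, one_smul]
    rw [← add_smul]; simp
  have hA : margA ρ' = (1 - κ) • margA τ + (κ * τ.trace.re) • α := by
    simp only [ρ', margA_add, margA_smul, margA_kronecker, trace_margB]
    rw [hc', mul_smul]
    simp
  have h1 : 0 ≤ (1 - κ) • τ := smul_nonneg (by linarith) hτ
  have h2 : 0 ≤ κ • (α ⊗ₖ margB τ) := smul_nonneg hκ.le hαβ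
  refine ⟨add_nonneg h1 h2, le_add_of_nonneg_right h2, ?_, ?_⟩
  · rw [← trace_margB ρ', hB, trace_margB]
  -- Since 1 ≤ L, the admixture is absorbed: (1 - κ) L + κ ≤ L.
  · have h3 : ρ' ≤ L • (α ⊗ₖ margB τ) := by
      have h4 : (1 - κ) • τ ≤ (1 - κ) • (L • (α ⊗ₖ margB τ)) :=
        smul_le_smul_of_nonneg_left h (by linarith)
      calc ρ' ≤ (1 - κ) • (L • (α ⊗ₖ margB τ)) + κ • (α ⊗ₖ margB τ) := by
            simp only [ρ']; gcongr
        _ = ((1 - κ) * L + κ) • (α ⊗ₖ margB τ) := by rw [smul_smul, add_smul]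
        _ ≤ L • (α ⊗ₖ margB τ) := smul_le_smul_of_nonneg_right (by nlinarith) hαβ
    have h5 : (κ / 2) • α ≤ margA ρ' := by
      rw [hA]
      have : (κ / 2) • α ≤ (κ * τ.trace.re) • α :=
        smul_le_smul_of_nonneg_right (by nlinarith) hα0
      exact this.trans (le_add_of_nonneg_left (smul_nonneg (by linarith) (margA_nonneg hτ)))
    have h6 := kronecker_mono_left h5 hβ
    rw [smul_kronecker] at h6
    refine h3.trans ?_
    have h7 := smul_le_smul_of_nonneg_left h6 (by positivity : 0 ≤ 2 * L / κ)
    rw [hB]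
    refine le_trans (le_of_eq ?_) h7
    rw [smul_smul]
    congr 1
    field_simp

theorem one_sub_kronecker (E : Matrix A A ℂ) :
    1 - E ⊗ₖ (1 : Matrix B B ℂ) = (1 - E) ⊗ₖ (1 : Matrix B B ℂ) := by
  rw [← one_kronecker_one]
  ext ⟨a, b⟩ ⟨a', b'⟩
  simp only [Matrix.sub_apply, kronecker_apply]
  ring

end Smoothing

/-! ### Construction of the smoothed state. -/

section Chain
variable {A B : Type*} [Fintype A] [DecidableEq A] [Fintype B] [DecidableEq B]

theorem trace_re_smul (r : ℝ) (M : Matrix A A ℂ) : (r • M).trace.re = r * M.trace.re := by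
  simp [trace_smul]

theorem margA_mem_states {ρ : Matrix (A × B) (A × B) ℂ} (hρ : ρ ∈ states (A × B)) :
    margA ρ ∈ states A :=
  ⟨nonneg_iff_posSemidef.1 (margA_nonneg hρ.1.nonneg), by rw [trace_margA, hρ.2]⟩

theorem hsSq_kronecker_mul (E : Matrix A A ℂ) (M : Matrix (A × B) (A × B) ℂ) :
    hsSq ((E ⊗ₖ (1 : Matrix B B ℂ)) * M) = (E * margA (M * Mᴴ) * Eᴴ).trace.re := by
  rw [hsSq_mul_eq, ← trace_margA, margA_conj]

/-- The weight of an amplitude close to `√ρ` outside of a spectral subspace of an operator close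
to `ρ_A`. -/
theorem hsSq_cut_le {ρ : Matrix (A × B) (A × B) ℂ} (hρ : ρ ∈ states (A × B)) {η : ℝ} (hη : 0 ≤ η)
    {M : Matrix A A ℂ} (hM : M ∈ epsBall η (margA ρ)) {Y : Matrix (A × B) (A × B) ℂ}
    (hY : hsSq (CFC.sqrt ρ - Y) ≤ 2 * η ^ 2) {E : Matrix A A ℂ} (hE : Eᴴ = E) (hEE : E * E = E)
    {μ : ℝ} (hμ : (E * M * Eᴴ).trace.re ≤ μ) :
    hsSq ((E ⊗ₖ (1 : Matrix B B ℂ)) * Y) ≤ 25 / 16 * μ + 45 / 2 * η ^ 2 := by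
  obtain ⟨Y', hY', hXY', -⟩ := exists_close_amplitude (margA_mem_states hρ) hη hM
  have hÊ : (E ⊗ₖ (1 : Matrix B B ℂ))ᴴ = E ⊗ₖ (1 : Matrix B B ℂ) := by
    rw [conjTranspose_kronecker, hE, conjTranspose_one]
  have hÊÊ : (E ⊗ₖ (1 : Matrix B B ℂ)) * (E ⊗ₖ (1 : Matrix B B ℂ)) = E ⊗ₖ (1 : Matrix B B ℂ) := by
    rw [← mul_kronecker_mul, hEE, one_mul]
  have h1 : hsSq (E * Y') ≤ μ := by
    rw [hsSq_mul_eq]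
    exact (trace_re_mono (conj_le_conj E hY')).trans hμ
  have h2 : hsSq (E * CFC.sqrt (margA ρ)) ≤ 5 / 4 * μ + 10 * η ^ 2 := by
    have h := hsSq_add_le (E * Y') (E * (CFC.sqrt (margA ρ) - Y'))
    rw [← Matrix.mul_add, add_sub_cancel] at h
    have h' := hsSq_mul_proj_le hE hEE (CFC.sqrt (margA ρ) - Y')
    linarith
  -- Weights under `E ⊗ 1` depend only on the A-marginal, so the estimate passes from √ρ_A to √ρ. A
  -- second use of `hsSq_add_le` moves it to `Y`, whence 25/16 = (5/4)².
  have h3 : hsSq ((E ⊗ₖ (1 : Matrix B B ℂ)) * CFC.sqrt ρ) = hsSq (E * CFC.sqrt (margA ρ)) := by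
    rw [hsSq_kronecker_mul, hsSq_mul_eq, sqrt_conjTranspose, sqrt_conjTranspose,
      CFC.sqrt_mul_sqrt_self ρ hρ.1.nonneg,
      CFC.sqrt_mul_sqrt_self (margA ρ) (margA_nonneg hρ.1.nonneg)]
  have h := hsSq_add_le ((E ⊗ₖ (1 : Matrix B B ℂ)) * CFC.sqrt ρ)
    ((E ⊗ₖ (1 : Matrix B B ℂ)) * (Y - CFC.sqrt ρ))
  rw [← Matrix.mul_add, add_sub_cancel, h3] at h
  have h' := hsSq_mul_proj_le hÊ hÊÊ (Y - CFC.sqrt ρ)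
  rw [hsSq_sub_comm] at h'
  linarith

/-- The loss 4η² + 2m + 2t collects the distance of `Y` from √ρ, the weight m cut away on A and the
weight t filtered away on B. Mixing costs the factor √(1 - κ). -/
theorem exists_smoothed_state {ρ : Matrix (A × B) (A × B) ℂ} (hρ : ρ ∈ states (A × B))
    {η : ℝ} (hη : 0 ≤ η) {ρ₁ : Matrix A A ℂ} (hρ₁ : ρ₁ ∈ epsBall η (margA ρ))
    {ρ₂ : Matrix (A × B) (A × B) ℂ} (hρ₂ : ρ₂ ∈ epsBall η ρ) {σ : Matrix B B ℂ}
    (hσ : σ ∈ states B) {Λ : ℝ} (hΛ : 0 ≤ Λ) (hle : ρ₂ ≤ Λ • ((1 : Matrix A A ℂ) ⊗ₖ σ))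
    {s t κ m : ℝ} (hs : 0 < s) (ht : 0 < t) (hκ : 0 < κ) (hκ1 : κ ≤ 1)
    (hm : 25 / 16 * (√s * (CFC.sqrt ρ₁).trace.re) + 45 / 2 * η ^ 2 ≤ m)
    (hsmall : 4 * η ^ 2 + 2 * m + 2 * t ≤ 1) :
    ∃ ρ' ∈ subStates (A × B),
      √(1 - κ) * (1 - (4 * η ^ 2 + 2 * m + 2 * t)) ≤ fidelity ρ ρ' ∧
      ρ' ≤ (2 * (Λ / (t * s)) / κ) • (margA ρ' ⊗ₖ margB ρ') := by
  obtain ⟨Y, hY, hXY, hY1⟩ := exists_close_amplitude hρ hη hρ₂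
  obtain ⟨⟨hρ₁0, hρ₁p, hρ₁1⟩, -⟩ := id hρ₁
  obtain ⟨⟨-, -, hρ₂1⟩, -⟩ := hρ₂
  obtain ⟨E, hE, hEE, hcut, hEμ⟩ := exists_spectral_cut hρ₁0.nonneg hs
  have hm1 := hsSq_cut_le hρ hη hρ₁ hXY hE hEE hEμ
  set Ê := E ⊗ₖ (1 : Matrix B B ℂ) with hÊdef
  have hÊ : Êᴴ = Ê := by rw [hÊdef, conjTranspose_kronecker, hE, conjTranspose_one]
  have hÊÊ : Ê * Ê = Ê := by rw [hÊdef, ← mul_kronecker_mul, hEE, one_mul]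
  set Z := (1 - Ê) * Y with hZ
  have hYZ := hsSq_mul_proj hÊ hÊÊ Y
  rw [← hZ] at hYZ
  have hQ : (1 - E) * (1 - E)ᴴ = 1 - E := by
    simp [hE, Matrix.mul_sub, Matrix.sub_mul, hEE]
  have hτ0 := mul_conjTranspose_nonneg Z
  have hτle : Z * Zᴴ ≤ Λ • ((1 - E) ⊗ₖ σ) := by
    have h := conj_le_conj (1 - Ê) (hY.trans hle)
    refine le_trans (le_of_eq ?_) (h.trans (le_of_eq ?_))
    · rw [hZ, conjTranspose_mul]; simp only [Matrix.mul_assoc]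
    · rw [hÊdef, one_sub_kronecker, conjTranspose_kronecker, Matrix.mul_smul, Matrix.smul_mul,
        ← mul_kronecker_mul, ← mul_kronecker_mul, mul_one, hQ, conjTranspose_one, mul_one, one_mul]
  obtain ⟨G, hGσ, hGG, hGt⟩ := exists_filter (margB_nonneg hτ0) hσ.1.nonneg (by simp [hσ.2]) ht
  set V := ((1 : Matrix A A ℂ) ⊗ₖ G) * Z with hV
  have hVV : V * Vᴴ = ((1 : Matrix A A ℂ) ⊗ₖ G) * (Z * Zᴴ) * ((1 : Matrix A A ℂ) ⊗ₖ G)ᴴ := by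
    rw [hV, conjTranspose_mul]; simp only [Matrix.mul_assoc]
  have hτ'0 := mul_conjTranspose_nonneg V
  have hβ : margB (V * Vᴴ) = G * margB (Z * Zᴴ) * Gᴴ := by rw [hVV, margB_conj]
  have hhsV : hsSq V = (G * margB (Z * Zᴴ)).trace.re := by
    rw [← hGG, ← hβ, trace_margB, hsSq]
  have hZV : (Z * Vᴴ).trace.re = (G * margB (Z * Zᴴ)).trace.re := by
    rw [← trace_one_kronecker_mul (A := A), ← trace_conjTranspose_re, conjTranspose_mul,
      conjTranspose_conjTranspose, hV, Matrix.mul_assoc]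
  have hhsZ : (margB (Z * Zᴴ)).trace.re = hsSq Z := by rw [trace_margB, hsSq]
  -- The filter behaves like an orthogonal projection on `Z`: the overlap of `Z` with `V` equals
  -- ‖V‖².
  have hm2 : hsSq (Z - V) = hsSq Z - hsSq V := by
    rw [hsSq_sub, hZV, hhsV]; ring
  rw [hhsZ, ← hhsV] at hGt
  -- the overlap with `√ρ`
  have hX : hsSq (CFC.sqrt ρ) = 1 := by rw [hsSq_sqrt hρ.1.nonneg, hρ.2]; simp
  have hdist : hsSq (CFC.sqrt ρ - V) ≤ 3 * (2 * η ^ 2 + m + t) := by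
    have h := hsSq_add_add_le (CFC.sqrt ρ - Y) (Ê * Y) (Z - V)
    have e : CFC.sqrt ρ - Y + Ê * Y + (Z - V) = CFC.sqrt ρ - V := by
      rw [hZ, Matrix.sub_mul, one_mul]; abel
    rw [e] at h
    linarith
  have hVlow : 1 - 2 * η ^ 2 - m - t ≤ hsSq V := by linarith
  -- Polarisation: twice the overlap is 1 + ‖V‖² - ‖√ρ - V‖².
  have hoverlap : 1 - (4 * η ^ 2 + 2 * m + 2 * t) ≤ (CFC.sqrt ρ * V).trace.re := by
    have h := hsSq_sub (CFC.sqrt ρ) V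
    have e : (CFC.sqrt ρ * Vᴴ).trace.re = (CFC.sqrt ρ * V).trace.re := by
      rw [← trace_conjTranspose_re, conjTranspose_mul, conjTranspose_conjTranspose,
        sqrt_conjTranspose, trace_mul_comm]
    rw [hX, e] at h
    linarith
  -- the bound by a product with the filtered marginal
  set α := (ρ₁.trace.re)⁻¹ • ρ₁ with hα
  have hα0 : 0 ≤ α := smul_nonneg (by positivity) hρ₁0.nonneg
  have hαs : α ∈ states A := by
    refine ⟨nonneg_iff_posSemidef.1 hα0, ?_⟩
    rw [hα, trace_smul, ofReal_trace_re hρ₁0.nonneg]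
    simp only [Complex.ofReal_re, Complex.real_smul]
    rw [← Complex.ofReal_mul, inv_mul_cancel₀ hρ₁p.ne', Complex.ofReal_one]
  -- Normalising ρ₁ can only enlarge it, as tr ρ₁ ≤ 1.
  have hQα : s • (1 - E) ≤ α := by
    refine hcut.trans ?_
    have h := smul_le_smul_of_nonneg_right (one_le_inv_iff₀.2 ⟨hρ₁p, hρ₁1⟩) hρ₁0.nonneg
    rwa [one_smul] at h
  have hQ0 : 0 ≤ 1 - E := by rw [← hQ]; exact mul_conjTranspose_nonneg _
  have hβ0 := margB_nonneg hτ'0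
  have hτ'le : V * Vᴴ ≤ (Λ / (t * s)) • (α ⊗ₖ margB (V * Vᴴ)) := by
    calc V * Vᴴ ≤ Λ • ((1 - E) ⊗ₖ (G * σ * Gᴴ)) := by
          rw [hVV]
          refine (conj_le_conj _ hτle).trans (le_of_eq ?_)
          rw [conjTranspose_kronecker, Matrix.mul_smul, Matrix.smul_mul,
            ← mul_kronecker_mul, ← mul_kronecker_mul, one_mul, conjTranspose_one, mul_one]
      _ ≤ Λ • ((1 - E) ⊗ₖ (t⁻¹ • margB (V * Vᴴ))) := by
          rw [hβ]
          exact smul_le_smul_of_nonneg_left (kronecker_mono_right hQ0 hGσ) hΛ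
      _ = (Λ / (t * s)) • ((s • (1 - E)) ⊗ₖ margB (V * Vᴴ)) := by
          rw [kronecker_smul, smul_kronecker, smul_smul, smul_smul]
          congr 1
          field_simp
      _ ≤ _ := smul_le_smul_of_nonneg_left (kronecker_mono_left hQα hβ0) (by positivity)
  have hcV : 1 / 2 ≤ (V * Vᴴ).trace.re := by
    have e : (V * Vᴴ).trace.re = hsSq V := rfl
    rw [e]; linarith
  -- Both sides of `hτ'le` have trace proportional to tr V Vᴴ, which is positive.
  have hL : 1 ≤ Λ / (t * s) := by
    have h := trace_re_mono hτ'le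
    rw [trace_smul, trace_kronecker, hαs.2, one_mul, trace_margB, Complex.smul_re,
      smul_eq_mul] at h
    by_contra! hlt
    nlinarith
  obtain ⟨h0, hge, htr, hmain⟩ := mix_le_marginals hτ'0 hαs hκ hκ1 hL hτ'le hcV
  refine ⟨_, ⟨nonneg_iff_posSemidef.1 h0, by rw [htr]; linarith, ?_⟩, ?_, hmain⟩
  · rw [htr]
    have e : (V * Vᴴ).trace.re = hsSq V := rfl
    have h1 := (trace_re_mono hY).trans hρ₂1
    rw [← hsSq] at h1
    have h2 := hsSq_nonneg (Ê * Y)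
    have h3 := hsSq_nonneg (Z - V)
    rw [e]; linarith
  · rw [fidelity_of_state hρ]
    have hW : (√(1 - κ) • V) * (√(1 - κ) • V)ᴴ = (1 - κ) • (V * Vᴴ) := by
      rw [conjTranspose_smul, Matrix.smul_mul, Matrix.mul_smul, smul_smul, star_trivial,
        Real.mul_self_sqrt (by linarith)]
    refine le_trans ?_ (re_trace_le_traceNorm (CFC.sqrt ρ) (W := √(1 - κ) • V) (hW.trans_le hge))
    rw [Matrix.mul_smul, trace_re_smul]
    exact mul_le_mul_of_nonneg_left hoverlap (Real.sqrt_nonneg _)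

end Chain

/-! ### Choice of parameters and extended-real entropies. -/

section Entropies
variable {n : Type*} [Fintype n] [DecidableEq n]

theorem self_mem_epsBall {ρ : Matrix n n ℂ} (hρ : ρ ∈ states n) {η : ℝ} (hη : 0 ≤ η) :
    ρ ∈ epsBall η ρ := by
  refine ⟨⟨hρ.1, by simp [hρ.2], by simp [hρ.2]⟩, ?_⟩
  have h : fidelity ρ ρ = 1 := by
    rw [fidelity_of_state hρ, CFC.sqrt_mul_sqrt_self ρ hρ.1.nonneg, traceNorm, hρ.1.1,
      CFC.sqrt_mul_self ρ hρ.1.nonneg, hρ.2, Complex.one_re]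
  simpa [purifiedDist, h] using hη

theorem trace_sqrt_pos {ρ : Matrix n n ℂ} (hρ : ρ ∈ subStates n) :
    0 < (CFC.sqrt ρ).trace.re := by
  have h0 := CFC.sqrt_nonneg ρ
  refine lt_of_le_of_ne (trace_re_nonneg h0) fun h => ?_
  have h1 : (CFC.sqrt ρ).trace = 0 := by rw [ofReal_trace_re h0, ← h, Complex.ofReal_zero]
  have h2 := (nonneg_iff_posSemidef.1 h0).trace_eq_zero_iff.1 h1
  have h3 := CFC.sqrt_mul_sqrt_self ρ hρ.1.nonneg
  rw [h2, zero_mul] at h3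
  have h4 := hρ.2.1
  rw [← h3] at h4
  simp at h4

theorem exists_le_smul_one (M : Matrix n n ℂ) (hM : 0 ≤ M) :
    ∃ r : ℝ, 0 < r ∧ M ≤ r • (1 : Matrix n n ℂ) := by
  obtain ⟨r, hr⟩ := M.finite_real_spectrum.bddAbove
  refine ⟨max r 1, by positivity, ?_⟩
  have h := le_algebraMap_of_spectrum_le (R := ℝ) (r := max r 1) (a := M)
    (fun x hx => (hr hx).trans (le_max_left _ _)) hM.isSelfAdjoint
  rwa [Algebra.algebraMap_eq_smul_one] at h

variable {A B : Type*} [Fintype A] [DecidableEq A] [Fintype B] [DecidableEq B]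

/-- The maximally mixed state is a feasible σ. This keeps the smooth min-entropy away from -∞. -/
theorem exists_le_one_kronecker {ρ : Matrix (A × B) (A × B) ℂ} (hρ : ρ ∈ states (A × B)) :
    ∃ σ ∈ states B, ∃ x : ℝ, ρ ≤ ((2 : ℝ) ^ x) • ((1 : Matrix A A ℂ) ⊗ₖ σ) := by
  obtain ⟨r, hr, h⟩ := exists_le_smul_one ρ hρ.1.nonneg
  have hB : Nonempty B := by
    by_contra hB
    rw [not_nonempty_iff] at hB
    have := hρ.2
    simp [trace] at this
  have hd : (0 : ℝ) < Fintype.card B := by exact_mod_cast Fintype.card_pos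
  refine ⟨((Fintype.card B : ℝ)⁻¹) • 1, ⟨?_, ?_⟩, Real.logb 2 (r * Fintype.card B), ?_⟩
  · exact nonneg_iff_posSemidef.1 (smul_nonneg (by positivity) zero_le_one)
  · rw [trace_smul, trace_one, Complex.real_smul]
    push_cast
    exact inv_mul_cancel₀ (by exact_mod_cast hd.ne')
  · rw [Real.rpow_logb (by norm_num) (by norm_num) (by positivity), kronecker_smul,
      one_kronecker_one, smul_smul, mul_assoc, mul_inv_cancel₀ hd.ne', mul_one]
    exact h

/-- It suffices that 2 + 3/(1 - ε) ≥ 5 and 1 - √(1 - ε²) ≤ ε². -/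
theorem five_div_sq_le {ε : ℝ} (hε : 0 < ε) (hε1 : ε < 1) :
    5 / ε ^ 2 ≤ (2 * (1 - ε) + 3) / ((1 - ε) * (1 - √(1 - ε ^ 2))) := by
  have h0 : 0 < 1 - ε ^ 2 := by nlinarith
  have h1 : √(1 - ε ^ 2) < 1 := by
    rw [Real.sqrt_lt' one_pos]; nlinarith
  have h2 : 1 - ε ^ 2 ≤ √(1 - ε ^ 2) := Real.le_sqrt_of_sq_le (by nlinarith)
  have h3 : 0 < 1 - √(1 - ε ^ 2) := by linarith
  have h4 : 0 < 1 - ε := by linarith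
  rw [div_le_div_iff₀ (by positivity) (by positivity)]
  have h5 : (1 - ε) * (1 - √(1 - ε ^ 2)) ≤ (1 - ε) * ε ^ 2 := by gcongr; linarith
  nlinarith [pow_pos hε 2, pow_pos hε 3]

theorem smoothMaxInfo₁_le {ρ : Matrix (A × B) (A × B) ℂ} (hρ : ρ ∈ states (A × B))
    {ε ε' : ℝ} (hε : 0 < ε) (hε' : 0 < ε') (hsmall : ε + 2 * √ε + ε' < 1)
    {ρ₁ : Matrix A A ℂ} (hρ₁ : ρ₁ ∈ epsBall (ε' ^ 2 / 48) (margA ρ))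
    {ρ₂ : Matrix (A × B) (A × B) ℂ} (hρ₂ : ρ₂ ∈ epsBall (ε' ^ 2 / 48) ρ) {σ : Matrix B B ℂ}
    (hσ : σ ∈ states B) {x : ℝ} (hle : ρ₂ ≤ ((2 : ℝ) ^ x) • ((1 : Matrix A A ℂ) ⊗ₖ σ)) :
    smoothMaxInfo₁ (ε + 2 * √ε + ε') ρ ≤
      ((maxEntropy ρ₁ + x + (g ε - l ε') : ℝ) : EReal) := by
  have hsq : √ε ^ 2 = ε := Real.sq_sqrt hε.le
  have hsqpos : 0 < √ε := Real.sqrt_pos.2 hε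
  have hε14 : ε ≤ 1 / 4 := by nlinarith
  have hε'1 : ε' < 1 := by linarith
  have hη2 : (ε' ^ 2 / 48) ^ 2 ≤ ε' ^ 2 / 2304 := by
    have : ε' ^ 2 ≤ 1 := by nlinarith
    nlinarith [sq_nonneg ε']
  have hε'sq : ε' ^ 2 ≤ 1 := by nlinarith
  have hε'p : 0 < ε' ^ 2 := by positivity
  have hq := trace_sqrt_pos hρ₁.1
  set q := (CFC.sqrt ρ₁).trace.re with hqdef
  set η := ε' ^ 2 / 48 with hη
  have hs : √((ε' ^ 2 / 9 / q) ^ 2) * q = ε' ^ 2 / 9 := by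
    rw [Real.sqrt_sq (by positivity)]
    field_simp
  set f := 4 * η ^ 2 + 2 * (25 / 16 * (ε' ^ 2 / 9) + 45 / 2 * η ^ 2) + 2 * (ε / 2) with hf
  have hf1 : f ≤ 1 := by rw [hf]; linarith
  have hf0 : 0 ≤ f := by positivity
  -- The choice of s makes √s tr √ρ₁ equal to ε'²/9, and t = κ = ε/2 produces the factor 1/ε².
  obtain ⟨ρ', hρ's, hF, hmain⟩ := exists_smoothed_state hρ (by positivity) hρ₁ hρ₂ hσ
    (by positivity) hle (s := (ε' ^ 2 / 9 / q) ^ 2) (t := ε / 2) (κ := ε / 2)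
    (m := 25 / 16 * (ε' ^ 2 / 9) + 45 / 2 * η ^ 2) (by positivity) (by positivity) (by positivity)
    (by linarith) (by rw [hs]) hf1
  rw [← hf] at hF
  have hball : ρ' ∈ epsBall (ε + 2 * √ε + ε') ρ := by
    refine ⟨hρ's, (Real.sqrt_le_left (by positivity)).2 ?_⟩
    have h1 : (1 - ε / 2) * (1 - f) ^ 2 ≤ fidelity ρ ρ' ^ 2 := by
      calc (1 - ε / 2) * (1 - f) ^ 2 = (√(1 - ε / 2) * (1 - f)) ^ 2 := by
            rw [mul_pow, Real.sq_sqrt (by linarith)]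
        _ ≤ _ := by gcongr
    have h2 : 1 - (1 - ε / 2) * (1 - f) ^ 2 ≤ ε / 2 + 2 * f := by
      have : 0 ≤ f * (2 - f) := mul_nonneg hf0 (by linarith)
      nlinarith
    have h3 : 4 * ε + ε' ^ 2 ≤ (ε + 2 * √ε + ε') ^ 2 := by
      nlinarith [mul_pos hε hsqpos, mul_pos hε hε', mul_pos hsqpos hε', mul_pos hε hε]
    -- The squared purified distance is at most κ + 2f, which fits below (2√ε)² + ε'².
    have h4 : ε / 2 + 2 * f ≤ 4 * ε + ε' ^ 2 := by rw [hf]; linarith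
    linarith
  have hε1 : ε < 1 := by linarith
  have hG := five_div_sq_le hε hε1
  have hGpos : 0 < (2 * (1 - ε) + 3) / ((1 - ε) * (1 - √(1 - ε ^ 2))) :=
    lt_of_lt_of_le (by positivity) hG
  have hpow : (2 : ℝ) ^ (maxEntropy ρ₁ + x + (g ε - l ε')) =
      q ^ 2 * 2 ^ x * ((2 * (1 - ε) + 3) / ((1 - ε) * (1 - √(1 - ε ^ 2))) * (576 / ε' ^ 4)) := by
    have h2 : (0 : ℝ) < 2 := by norm_num
    have h2' : (2 : ℝ) ≠ 1 := by norm_num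
    have hl : (2 : ℝ) ^ l ε' = (ε' ^ 2 / 24) ^ 2 := by
      rw [l, mul_comm, Real.rpow_mul h2.le, Real.rpow_logb h2 h2' (by positivity)]
      norm_cast
    rw [Real.rpow_add h2, Real.rpow_add h2, Real.rpow_sub h2, hl, maxEntropy, g,
      Real.rpow_logb h2 h2' hGpos, traceNorm_sqrt, Real.rpow_logb h2 h2' (by positivity)]
    congr 1
    field_simp
    norm_num
  have hK : 2 * ((2 : ℝ) ^ x / (ε / 2 * (ε' ^ 2 / 9 / q) ^ 2)) / (ε / 2) ≤
      (2 : ℝ) ^ (maxEntropy ρ₁ + x + (g ε - l ε')) := by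
    rw [hpow]
    calc 2 * ((2 : ℝ) ^ x / (ε / 2 * (ε' ^ 2 / 9 / q) ^ 2)) / (ε / 2)
        = q ^ 2 * 2 ^ x * (648 / 576 / ε ^ 2 * (576 / ε' ^ 4)) := by field_simp; norm_num
      -- Here 576/ε'⁴ is 2^(-l), and 648/576 ≤ 5 leaves room to spare.
      _ ≤ q ^ 2 * 2 ^ x * (5 / ε ^ 2 * (576 / ε' ^ 4)) := by gcongr; norm_num
      _ ≤ _ := by gcongr
  refine (iInf₂_le ρ' hball).trans (sInf_le ⟨_, rfl, hmain.trans ?_⟩)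
  refine smul_le_smul_of_nonneg_right hK ?_
  have h0 := hρ's.1.nonneg
  exact ((nonneg_iff_posSemidef.1 (margA_nonneg h0)).kronecker
    (nonneg_iff_posSemidef.1 (margB_nonneg h0))).nonneg

end Entropies

end MaxInfo

open MaxInfo in
theorem mainTheorem6 {A B : Type*} [Fintype A] [DecidableEq A] [Fintype B] [DecidableEq B]
    (ρ : Matrix (A × B) (A × B) ℂ) (hρ : ρ ∈ MaxInfo.states (A × B))
    (ε ε' : ℝ) (hε : 0 < ε) (hε' : 0 < ε') (hsmall : ε + 2 * √ε + ε' < 1) :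
    MaxInfo.smoothMaxInfo₁ (ε + 2 * √ε + ε') ρ ≤
      MaxInfo.smoothMaxEntropy (ε' ^ 2 / 48) (MaxInfo.margA ρ)
        - MaxInfo.smoothCondMinEntropy (ε' ^ 2 / 48) ρ
        + ((MaxInfo.g ε - MaxInfo.l ε' : ℝ) : EReal) := by
  have hη : 0 ≤ ε' ^ 2 / 48 := by positivity
  have core := fun ρ₁ hρ₁ ρ₂ hρ₂ σ hσ x hle =>
    smoothMaxInfo₁_le hρ hε hε' hsmall (ρ₁ := ρ₁) hρ₁ (ρ₂ := ρ₂) hρ₂ (σ := σ) hσ (x := x) hle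
  obtain ⟨σ₀, hσ₀, x₀, hx₀⟩ := exists_le_one_kronecker hρ
  -- With ρ and ρ_A themselves as competitors, the left side is below +∞ and, once it is real, the
  -- smooth min-entropy is finite; no ∞ - ∞ occurs in the difference.
  have hρ₂ := self_mem_epsBall hρ hη
  have hρ₁ := self_mem_epsBall (margA_mem_states hρ) hη
  have htop := core _ hρ₁ _ hρ₂ _ hσ₀ _ hx₀
  generalize smoothMaxInfo₁ (ε + 2 * √ε + ε') ρ = X at *
  generalize g ε - l ε' = K at *
  induction X with
  | bot => exact bot_le
  | top => exact absurd htop (not_le.2 (EReal.coe_lt_top _))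
  | coe r =>
    have hb : ∀ ρ₁ ∈ epsBall (ε' ^ 2 / 48) (margA ρ),
        smoothCondMinEntropy (ε' ^ 2 / 48) ρ ≤ ((maxEntropy ρ₁ + K - r : ℝ) : EReal) := by
      intro ρ₁ h₁
      refine iSup₂_le fun ρ₂ h₂ => ?_
      rw [condMinEntropy, EReal.neg_le, ← EReal.coe_neg]
      refine le_iInf₂ fun σ hσ => le_sInf ?_
      rintro _ ⟨x, rfl, hx⟩
      have h := core ρ₁ h₁ ρ₂ h₂ σ hσ x hx
      rw [EReal.coe_le_coe_iff] at h ⊢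
      linarith
    have hb' : ((-x₀ : ℝ) : EReal) ≤ smoothCondMinEntropy (ε' ^ 2 / 48) ρ := by
      refine le_trans ?_ (le_iSup₂_of_le ρ hρ₂ le_rfl)
      rw [condMinEntropy, EReal.coe_neg, EReal.neg_le_neg_iff]
      exact iInf₂_le_of_le σ₀ hσ₀ (sInf_le ⟨x₀, rfl, hx₀⟩)
    generalize smoothCondMinEntropy (ε' ^ 2 / 48) ρ = b at *
    induction b with
    | bot => exact absurd hb' (not_le.2 (EReal.bot_lt_coe _))
    | top => exact absurd (hb _ hρ₁) (not_le.2 (EReal.coe_lt_top _))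
    | coe b =>
      have ha : ((b + r - K : ℝ) : EReal) ≤ smoothMaxEntropy (ε' ^ 2 / 48) (margA ρ) := by
        refine le_iInf₂ fun ρ₁ h₁ => ?_
        have h := hb ρ₁ h₁
        rw [EReal.coe_le_coe_iff] at h ⊢
        linarith
      generalize smoothMaxEntropy (ε' ^ 2 / 48) (margA ρ) = a at *
      induction a with
      | bot => exact absurd ha (not_le.2 (EReal.bot_lt_coe _))
      | top => simp
      | coe a =>
        rw [EReal.coe_le_coe_iff] at ha
        rw [← EReal.coe_sub, ← EReal.coe_add, EReal.coe_le_coe_iff]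
        linarith
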